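/- Let $k\ge 1$ and let $\mathbb F_Q$ be the finite field with $Q$ elements. Consider the complete binary tree of depth $k$; the nodes of depth less than $k$ are called internal. **The $k$-round Tree protocol (honest Bob, arbitrary Alice).** Fix a 3-coloring $c$ of the tree such that every internal node and its two children carry three different colors; the node $v$ is handled by the agents $\mathcal A_{c(v)}$ of Alice and $\mathcal B_{c(v)}$ of Bob, located at $L_{c(v)}$. At each internal node $v$, in round $|v|+1$, Bob's agent sends a challenge $b_v\in\mathbb F_Q$, all challenges being independent and uniform, and Alice's agent answers $y_v\in\mathbb F_Q\cup\{\perp\}$, where $\perp$ means that she did not answer in time. The root is the commit phase, the other internal nodes are the sustain phase. At each leaf Alice's agent reveals a pair in $\{0,1\}\times\mathbb F_Q$, or does not respond ($\perp$). The leftmost alive path starts at the root and passes from each internal node to its left child if that child responds, otherwise to its right child if that one responds; if neither responds, or if the root does not respond, the protocol aborts. Along this path $v_0,\dots,v_k$ Bob computes, for the revealed bit $d$, $\alpha_{v_0}=y_{v_0}-b_{v_0}d$ and $\alpha_{v_i}=y_{v_i}-b_{v_i}\alpha_{v_{i-1}}$ for $1\le i\le k-1$. Alice *successfully reveals* $d$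 if the protocol does not abort and the pair revealed at the leaf $v_k$ is $(d,\alpha_{v_{k-1}})$. **Cheating strategies.** Alice's agents are classical and may share a random variable $\lambda$ with an arbitrary discrete distribution (the deterministic strategies are those with constant $\lambda$). A commit strategy $\mathrm{Comm}^*$ consists of the law of $\lambda$ and of the answer at the root as a function of $\lambda$ and $b_\varnothing$. An opening strategy $\mathrm{Open}^*$, which may depend on the bit to be revealed, consists of the answers at all other internal nodes and the pairs revealed at the leaves; what is done at the node $v$ is a function of $\lambda$ and of the challenges $b_w$ with $w\in\mathrm{Acc}(v)$, where $\mathrm{Acc}(v)$ is the set of internal nodes whose challenges are accessible at $v$. **Theorem.** The protocol is $\varepsilon$-sum-binding with $\varepsilon=\dfrac{5k}{\sqrt{2Q}}$, that is, $$\forall\,\mathrm{Comm}^*:\qquad \sum_{d=0}^{1}\ \sup_{\mathrm{Open}^*}\Pr\bigl[\text{Alice successfully reveals } d \,\big|\, (\mathrm{Comm}^*,\mathrm{Open}^*)\bigr]\ \le\ 1+\frac{5k}{\sqrt{2Q}},$$ in each of the following cases: 1. for every choice of sets $\mathrm{Acc}(v)$ of internal nodes of depth at most $|v|$ that contain neither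 the parent nor the brother of $v$; 2. in particular, for every coloring $c$ as above, when $\mathrm{Acc}(v)$ is the set of internal nodes $w$ such that either $c(w)=c(v)$ and $|w|\le|v|$, or $|w|\le |v|-2$ (the challenges issued at the same location so far, and those issued at the other locations at least two rounds earlier). -/

import Mathlib

namespace TreeCommitment

/-- A node of the binary tree is a string of letters `ℓ = false`, `r = true`, written with its
last letter first: `t :: w` is the child `w t` of `w`, and `[]` is the root.  The depth of a node
is its length. -/
abbrev Node := List Bool

/-- The internal nodes of the complete binary tree of depth `k`. -/
abbrev Internal (k : ℕ) := {v : Node // v.length < k}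

instance (k : ℕ) : Finite (Internal k) := (List.finite_length_lt Bool k).to_subtype

/-- `w` is the parent of `v`. -/
def IsParent (w v : Node) : Prop := ∃ t, v = t :: w

/-- `w` is the brother of `v`. -/
def IsBrother (w v : Node) : Prop := ∃ t u, v = t :: u ∧ w = (!t) :: u

/-- A 3-coloring of the tree of depth `k`: every internal node and its two children carry the
three colors. The agents in charge of the node `v` are those at location `c v`. -/
def IsColoring (k : ℕ) (c : Node → Fin 3) : Prop :=
  ∀ v : Node, v.length < k → ({c v, c (false :: v), c (true :: v)} : Set (Fin 3)) = Set.univ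

/-- The challenges that can have reached location `c v` by the time (round `|v| + 1`) at which the
node `v` is played: all those of the same location up to that round, and those of the other
locations that were sent at least two rounds earlier. -/
def lightCone (k : ℕ) (c : Node → Fin 3) (v : Node) : Set (Internal k) :=
  {w | (w.1.length ≤ v.length ∧ c w.1 = c v) ∨ w.1.length + 2 ≤ v.length}

/-- An assignment of accessible nodes `Acc v ⊆ V_{≤ |v|}` to the nodes `v` of the tree of depth
`k`, such that neither the parent nor the brother of `v` is accessible at `v`. -/
def IsAccess (k : ℕ) (Acc : Node → Set (Internal k)) : Prop :=
  ∀ v : Node, v.length ≤ k → ∀ w ∈ Acc v,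
    w.1.length ≤ v.length ∧ ¬ IsParent w.1 v ∧ ¬ IsBrother w.1 v

/-- Bob's challenges, one for every internal node. -/
abbrev Challenges (k : ℕ) (F : Type*) := Internal k → F

/-- The challenge at a node (`0` at the nodes that are not internal, where it plays no role). -/
def challenge {k : ℕ} {F : Type*} [Zero F] (b : Challenges k F) (v : Node) : F :=
  if h : v.length < k then b ⟨v, h⟩ else 0

/-- A classical strategy of Alice in the commit phase: a shared random variable, and the answer of
the agent at the root to her challenge. Here and below the answer `none` is `⊥`. The strategy is
deterministic if `Λ` has one element. -/
structure CommitStrategy (F : Type*) where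
  Λ : Type
  law : PMF Λ
  answer : Λ → F → Option F

/-- A classical strategy of Alice's agents after the commit phase: the answers at the nodes of
depth `1, …, k - 1` (sustain phase) and the bit and field element revealed at the leaves.
What is done at `v` depends only on the shared randomness and the challenges of `Acc v`.
Values at other nodes are never used. -/
structure OpenStrategy (k : ℕ) (F : Type*) (Acc : Node → Set (Internal k)) (Λ : Type) where
  answer : Λ → Node → Challenges k F → Option F
  reveal : Λ → Node → Challenges k F → Option (Bool × F)
  answer_local : ∀ l v, DependsOn (answer l v) (Acc v)
  reveal_local : ∀ l v, DependsOn (reveal l v) (Acc v)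

section Run

variable {k : ℕ} {F : Type*} [Field F] {Acc : Node → Set (Internal k)}
  (C : CommitStrategy F) (O : OpenStrategy k F Acc C.Λ) (l : C.Λ) (b : Challenges k F)

/-- The answer `y_v ∈ F ∪ {⊥}` at an internal node. -/
def answerAt : Node → Option F
  | [] => C.answer l (challenge b [])
  | t :: w => O.answer l (t :: w) b

/-- The agent at `v` responds in time. -/
def Responds (v : Node) : Prop :=
  if v.length < k then (answerAt C O l b v).isSome else (O.reveal l v b).isSome

open Classical in
/-- The last node `v_n` of the leftmost alive path up to depth `n`; `none` if the root is dead or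
if, at some smaller depth, the leftmost alive node has no alive child. -/
noncomputable def leftmostAlive : ℕ → Option Node
  | 0 => if Responds C O l b [] then some [] else none
  | n + 1 => (leftmostAlive n).bind fun v =>
      if Responds C O l b (false :: v) then some (false :: v)
      else if Responds C O l b (true :: v) then some (true :: v)
      else none

/-- The values recursively computed by Bob for the revealed bit `d`:
`α_∅ = y_∅ - b_∅ d` and `α_v = y_v - b_v α_{parent v}`.
They are only used along the leftmost alive path, where `y_v ≠ ⊥`. -/
def alpha (d : Bool) : Node → F
  | [] => (answerAt C O l b []).getD 0 - challenge b [] * (if d then 1 else 0)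
  | t :: w => (answerAt C O l b (t :: w)).getD 0 - challenge b (t :: w) * alpha d w

/-- Alice successfully reveals `d`: the leftmost alive path reaches a leaf `v`, and at `v` she
reveals `d` together with the value that Bob has computed at the parent of `v`. -/
def Reveals (d : Bool) : Prop :=
  ∃ v, leftmostAlive C O l b k = some v ∧ O.reveal l v b = some (d, alpha C O l b d v.tail)

/-- The probability that Alice successfully reveals `d`, over the shared randomness of her agents
and independent uniformly distributed challenges. -/
noncomputable def revealProb (d : Bool) : ℝ :=
  ∑' l : C.Λ, (C.law l).toReal *
    ((Nat.card {b : Challenges k F // Reveals C O l b d} : ℝ) / Nat.card (Challenges k F))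

end Run

/-- Sum-binding, for a protocol given by the possible strategies of Alice in the commit phase and
in the remaining phases and by the probability that they reveal `d` successfully. -/
def IsSumBinding {Comm : Type*} {Open : Comm → Type*} (pr : (C : Comm) → Open C → Bool → ℝ)
    (ε : ℝ) : Prop :=
  ∀ C : Comm, ∑ d : Bool, ⨆ O : Open C, pr C O d ≤ 1 + ε

/-- The `k`-round Tree protocol over `F` is `ε`-sum-binding against classical agents of Alice
whose accessible information is `Acc`. -/
def TreeIsSumBinding (k : ℕ) (F : Type*) [Field F] (Acc : Node → Set (Internal k)) (ε : ℝ) :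
    Prop :=
  IsSumBinding (Comm := CommitStrategy F) (Open := fun C => OpenStrategy k F Acc C.Λ)
    (fun C O d => revealProb C O d) ε

/-- The information that relativity leaves to the agents never includes the parent or the brother
of the node. -/
theorem lightCone_isAccess {k : ℕ} {c : Node → Fin 3} (hc : IsColoring k c) :
    IsAccess k (lightCone k c) := by
  have key : ∀ v : Node, v.length < k →
      c v ≠ c (false :: v) ∧ c v ≠ c (true :: v) ∧ c (false :: v) ≠ c (true :: v) := by
    intro v hv
    have h := hc v hv
    generalize c v = x, c (false :: v) = y, c (true :: v) = z at h
    have h0 : (0 : Fin 3) ∈ ({x, y, z} : Set (Fin 3)) := h ▸ Set.mem_univ _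
    have h1 : (1 : Fin 3) ∈ ({x, y, z} : Set (Fin 3)) := h ▸ Set.mem_univ _
    have h2 : (2 : Fin 3) ∈ ({x, y, z} : Set (Fin 3)) := h ▸ Set.mem_univ _
    simp only [Set.mem_insert_iff, Set.mem_singleton_iff] at h0 h1 h2
    clear h
    revert x y z
    decide
  intro v hv w hw
  refine ⟨by rcases hw with h | h <;> omega, ?_, ?_⟩
  · rintro ⟨t, rfl⟩
    have := key w.1 w.2
    rcases hw with ⟨-, h⟩ | h
    · cases t <;> simp_all
    · simp at h
  · rintro ⟨t, u, rfl, hw'⟩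
    have := key u (by simpa using hv)
    rcases hw with ⟨-, h⟩ | h
    · rw [hw'] at h
      cases t <;> simp_all
    · rw [hw'] at h
      simp at h

/-- The values `revealProb` are at most `1`, so that the suprema in `TreeIsSumBinding` are taken
over bounded (and non-empty) sets. -/
theorem revealProb_le_one {k : ℕ} {F : Type*} [Field F] {Acc : Node → Set (Internal k)}
    [Finite F] (C : CommitStrategy F) (O : OpenStrategy k F Acc C.Λ) (d : Bool) :
    revealProb C O d ≤ 1 := by
  have h1 : ∀ l : C.Λ, (C.law l).toReal *
      ((Nat.card {b : Challenges k F // Reveals C O l b d} : ℝ) / Nat.card (Challenges k F))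
      ≤ (C.law l).toReal := by
    intro l
    refine mul_le_of_le_one_right ENNReal.toReal_nonneg (div_le_one_of_le₀ ?_ (by positivity))
    exact_mod_cast Nat.card_le_card_of_injective _ Subtype.val_injective
  have hs : Summable fun l : C.Λ => (C.law l).toReal :=
    ENNReal.summable_toReal C.law.tsum_coe_ne_top
  have ht : ∑' l : C.Λ, (C.law l).toReal = 1 := by
    rw [← ENNReal.tsum_toReal_eq C.law.apply_ne_top, C.law.tsum_coe, ENNReal.toReal_one]
  exact (Summable.tsum_le_tsum h1 (Summable.of_nonneg_of_le (fun l => by positivity) h1 hs)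
    hs).trans ht.le

instance {k : ℕ} {F : Type*} {Acc : Node → Set (Internal k)} {Λ : Type} :
    Nonempty (OpenStrategy k F Acc Λ) :=
  ⟨⟨fun _ _ _ => none, fun _ _ _ => none, fun _ _ _ _ _ => rfl, fun _ _ _ _ _ => rfl⟩⟩

end TreeCommitment

/-! Fix the shared randomness. A leaf does not see the challenge of its parent, so revealing
successfully amounts to guessing `alpha` at the last internal node of the path blindly, that is,
without that node's challenge (`exists_blind_of_reveals`). The proof moves this guess up to the
root, one level at a time.

Let `v` be on the path and vary only the challenges `x` at `v` and `s`, `t` at its children. A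
correct blind guess at the left child says that the point `(s, y s)` lies on a line of slope `alpha
v`, which depends on `x`; blindness makes the intercept independent of `s`, and locality makes `y s`
independent of `x` and of `t`. Lines of different slopes meet at most once, so Cauchy-Schwarz bounds
the incidences (`sum_incidence_le`) by a main term, the size of the largest class of equal slopes,
plus an error of order `1 / √Q`. The main term is the success count of the most likely value of
`alpha v`, again a blind guess (`exists_blind_argmax`). The right child plays only when the left one
is dead, and together they cost at most `5 / (4 √Q)` (`sum_incidence_children_le`). The events "the
path passes through `v`" are disjoint for `v` of a given depth, so this is also the cost of a whole
round (`exists_blind_guesses_pred`).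

At the root both bits face the same answer `y`, and `y = g` and `y - b = g'` hold together for one
challenge `b` only (`sum_guesses_root_le`). The total excess is `1 / Q` plus `k - 1` rounds for each
bit. -/

namespace TreeCommitment

open Finset Function

/-! ### Counting with indicators -/

/-- The real-valued indicator of a proposition. -/
noncomputable def ind (p : Prop) : ℝ := open Classical in if p then 1 else 0

theorem ind_of {p : Prop} (h : p) : ind p = 1 := if_pos h

theorem ind_of_not {p : Prop} (h : ¬ p) : ind p = 0 := if_neg h

theorem ind_nonneg (p : Prop) : 0 ≤ ind p := by
  unfold ind; split_ifs <;> norm_num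

theorem ind_le_one (p : Prop) : ind p ≤ 1 := by
  unfold ind; split_ifs <;> norm_num

theorem ind_mono {p q : Prop} (h : p → q) : ind p ≤ ind q := by
  by_cases hp : p
  · rw [ind_of hp, ind_of (h hp)]
  · rw [ind_of_not hp]; exact ind_nonneg q

theorem ind_and (p q : Prop) : ind (p ∧ q) = ind p * ind q := by
  by_cases hp : p <;> by_cases hq : q <;> simp [ind, hp, hq]

theorem sum_ind_eq_card {ι : Type*} [Fintype ι] (p : ι → Prop) :
    ∑ i, ind (p i) = Nat.card {i // p i} := by
  classical
  simp [ind, Fintype.card_subtype]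

theorem sum_ind_eq_self {ι : Type*} [Fintype ι] (i : ι) : ∑ j, ind (j = i) = 1 := by
  classical
  simp [ind]

/-- The events are disjoint, since `o` determines `i`. Used to split over the node reached by the
path. -/
theorem sum_ind_some {ι α : Type*} [Fintype ι] {e : ι → α} (he : Injective e) (o : Option α)
    (p : ι → Prop) : ∑ i, ind (o = some (e i) ∧ p i) = ind (∃ i, o = some (e i) ∧ p i) := by
  by_cases h : ∃ i, o = some (e i) ∧ p i
  · obtain ⟨i, hi⟩ := h
    rw [ind_of ⟨i, hi⟩, Finset.sum_eq_single i, ind_of hi]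
    · rintro j - hj
      refine ind_of_not fun hj' => hj (he ?_)
      simpa using hj'.1.symm.trans hi.1
    · simp
  · rw [ind_of_not h]
    exact Finset.sum_eq_zero fun i _ => ind_of_not fun hi => h ⟨i, hi⟩

/-- Resampling one challenge preserves the uniform law: exchanging `b i` with `x` is an involution.
-/
theorem sum_sum_update {ι F : Type*} [Fintype ι] [DecidableEq ι] [Fintype F] (i : ι)
    (f : (ι → F) → ℝ) : ∑ b, ∑ x, f (update b i x) = Fintype.card F * ∑ b, f b := by
  have inv : Involutive fun q : (ι → F) × F => (update q.1 i q.2, q.1 i) := by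
    rintro ⟨b, x⟩
    simp
  have h := Equiv.sum_comp inv.toPerm fun q : (ι → F) × F => f q.1
  rw [Fintype.sum_prod_type, Fintype.sum_prod_type] at h
  simpa [Finset.mul_sum] using h

/-! ### Incidences between points and lines -/

section Incidence

variable {F : Type*} [Field F] [Fintype F]

/-- A bound on the incidences between the graph of a partial function `y` and the lines
`z ↦ z * a x + h x`, in terms of the maximal number `P` of indices `x` with the same slope. -/
theorem sum_incidence_le (X : F → Prop) (a h : F → F) (y : F → Option F) {P : ℝ}
    (hP : ∀ a₀, ∑ x, ind (X x ∧ a x = a₀) ≤ P) :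
    ∑ x, ∑ z, ind (X x ∧ ∃ u, y z = some u ∧ u - z * a x = h x) ≤
      (∑ z, ind (y z ≠ none)) * P + √(∑ z, ind (y z ≠ none)) * ∑ x, ind (X x) := by
  set I : F → F → ℝ := fun x z => ind (X x ∧ ∃ u, y z = some u ∧ u - z * a x = h x) with hI
  set E := ∑ x, ∑ z, I x z with hE
  set S := ∑ z, ind (y z ≠ none) with hS
  set M := ∑ x, ind (X x) with hM
  have hI0 : ∀ x z, 0 ≤ I x z := fun x z => ind_nonneg _
  have hE0 : 0 ≤ E := sum_nonneg fun x _ => sum_nonneg fun z _ => hI0 x z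
  have hS0 : 0 ≤ S := sum_nonneg fun z _ => ind_nonneg _
  have hM0 : 0 ≤ M := sum_nonneg fun x _ => ind_nonneg _
  have hP0 : 0 ≤ P := (sum_nonneg fun x _ => ind_nonneg _).trans (hP 0)
  -- Lines of different slopes share at most one point; for equal slopes the trivial bound is
  -- charged to the first term.
  have pair : ∀ x x', ∑ z, I x z * I x' z ≤
      ind (X x' ∧ a x' = a x) * ∑ z, I x z + ind (X x) * ind (X x') := by
    intro x x'
    by_cases hx : X x; swap
    · simp [hI, hx, ind]
    by_cases hx' : X x'; swap
    · simp [hI, hx', ind]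
    rw [ind_of hx, ind_of hx']
    by_cases ha : a x' = a x
    · rw [ind_of ⟨hx', ha⟩]
      have : ∑ z, I x z * I x' z ≤ ∑ z, I x z :=
        sum_le_sum fun z _ => mul_le_of_le_one_right (hI0 x z) (ind_le_one _)
      linarith
    · rw [ind_of_not fun h => ha h.2]
      have hne : a x - a x' ≠ 0 := sub_ne_zero.2 (Ne.symm ha)
      have : ∀ z, I x z * I x' z ≤ ind (z = (h x' - h x) / (a x - a x')) := by
        intro z
        rw [hI]
        simp only [← ind_and]
        refine ind_mono ?_
        rintro ⟨⟨-, u, hu, h1⟩, -, u', hu', h2⟩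
        obtain rfl : u = u' := by simpa using hu.symm.trans hu'
        rw [eq_div_iff hne]
        linear_combination h2 - h1
      have := sum_le_sum fun z (_ : z ∈ univ) => this z
      rw [sum_ind_eq_self] at this
      linarith
  have cs : E ^ 2 ≤ S * ∑ z, (∑ x, I x z) ^ 2 := by
    have h1 : E = ∑ z, ind (y z ≠ none) * ∑ x, I x z := by
      rw [hE, sum_comm]
      refine sum_congr rfl fun z _ => ?_
      rw [mul_sum]
      refine sum_congr rfl fun x _ => ?_
      rw [hI]
      simp only [← ind_and]
      congr 1
      refine propext ⟨fun h => ⟨?_, h⟩, fun h => h.2⟩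
      obtain ⟨-, u, hu, -⟩ := h
      simp [hu]
    have h2 : S = ∑ z, ind (y z ≠ none) ^ 2 :=
      sum_congr rfl fun z _ => by rw [sq, ← ind_and, and_self]
    rw [h1, h2]
    exact sum_mul_sq_le_sq_mul_sq _ _ _
  have exp : ∑ z, (∑ x, I x z) ^ 2 ≤ P * E + M * M := by
    calc ∑ z, (∑ x, I x z) ^ 2 = ∑ x, ∑ x', ∑ z, I x z * I x' z := by
          simp only [sq, sum_mul_sum]
          rw [sum_comm]
          exact sum_congr rfl fun x _ => sum_comm
      _ ≤ ∑ x, ∑ x', (ind (X x' ∧ a x' = a x) * ∑ z, I x z + ind (X x) * ind (X x')) :=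
          sum_le_sum fun x _ => sum_le_sum fun x' _ => pair x x'
      _ = ∑ x, (∑ x', ind (X x' ∧ a x' = a x)) * ∑ z, I x z + M * M := by
          simp only [sum_add_distrib, ← sum_mul, ← mul_sum, hM]
      _ ≤ P * E + M * M := by
          rw [hE, mul_sum _ _ P]
          refine add_le_add (sum_le_sum fun x _ => ?_) le_rfl
          exact mul_le_mul_of_nonneg_right (hP _) (sum_nonneg fun z _ => hI0 x z)
  have key : E ^ 2 ≤ S * (P * E + M * M) := cs.trans (by gcongr)
  -- `key` is quadratic in `E`: if `E > S P + √S M`, then `E (E - S P) > S M²`, a contradiction.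
  by_contra! hlt
  have hr := Real.sqrt_nonneg S
  have hr2 := Real.mul_self_sqrt hS0
  have hSP : 0 ≤ S * P := mul_nonneg hS0 hP0
  have hrM : 0 ≤ √S * M := mul_nonneg hr hM0
  have h1 : √S * M < E - S * P := by linarith
  have h2 : √S * M < E := by linarith
  have h3 : (√S * M) * (√S * M) < E * (E - S * P) :=
    mul_lt_mul'' h2 h1 hrM hrM
  have h4 : (√S * M) * (√S * M) = S * (M * M) := by
    rw [mul_mul_mul_comm, hr2]
  nlinarith

/-- The combined bound for the two children of a node: the left one plays if it is alive,
the right one otherwise. -/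
theorem sum_incidence_children_le (X : F → Prop) (a : F → F) (gl gr : F → F → F)
    (yl yr : F → Option F) {P : ℝ} (hP : ∀ a₀, ∑ x, ind (X x ∧ a x = a₀) ≤ P) :
    ∑ x, ∑ s, ∑ t, ind (X x ∧ ((∃ u, yl s = some u ∧ u - s * a x = gl x t) ∨
        (yl s = none ∧ ∃ u, yr t = some u ∧ u - t * a x = gr x s))) ≤
      (Fintype.card F : ℝ) ^ 2 * (P + 5 / (4 * √(Fintype.card F)) * ∑ x, ind (X x)) := by
  set Q : ℝ := (Fintype.card F : ℝ) with hQ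
  set M := ∑ x, ind (X x) with hM
  set S := ∑ z, ind (yl z ≠ none) with hS
  have hQ0 : 0 < Q := Nat.cast_pos.2 Fintype.card_pos
  have hP0 : 0 ≤ P := (sum_nonneg fun x _ => ind_nonneg _).trans (hP 0)
  have hM0 : 0 ≤ M := sum_nonneg fun x _ => ind_nonneg _
  have hS0 : 0 ≤ S := sum_nonneg fun z _ => ind_nonneg _
  have hle : ∀ y : F → Option F, ∑ z, ind (y z ≠ none) ≤ Q := fun y =>
    (sum_le_sum fun z _ => ind_le_one _).trans (by simp [hQ])
  have hnone : ∑ s, ind (yl s = none) = Q - S := by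
    rw [eq_sub_iff_add_eq, hS, ← sum_add_distrib]
    have : ∀ s, ind (yl s = none) + ind (yl s ≠ none) = 1 := fun s => by
      by_cases h : yl s = none <;> simp [ind, h]
    simp [this, hQ]
  have hl : ∀ t, ∑ x, ∑ s, ind (X x ∧ ∃ u, yl s = some u ∧ u - s * a x = gl x t) ≤
      S * P + √S * M := fun t => sum_incidence_le X a (fun x => gl x t) yl hP
  have hr : ∀ s, ∑ x, ∑ t, ind (X x ∧ ∃ u, yr t = some u ∧ u - t * a x = gr x s) ≤
      Q * P + √Q * M := fun s =>
    (sum_incidence_le X a (fun x => gr x s) yr hP).trans (by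
      have := hle yr
      gcongr)
  -- The left term is bounded for each fixed `t`, the right one for each fixed `s` at which the left
  -- child is dead.
  calc _ ≤ ∑ x, ∑ s, ∑ t, (ind (X x ∧ ∃ u, yl s = some u ∧ u - s * a x = gl x t) +
        ind (yl s = none) * ind (X x ∧ ∃ u, yr t = some u ∧ u - t * a x = gr x s)) := by
        refine sum_le_sum fun x _ => sum_le_sum fun s _ => sum_le_sum fun t _ => ?_
        rw [← ind_and]
        by_cases h : X x ∧ ∃ u, yl s = some u ∧ u - s * a x = gl x t
        · rw [ind_of h]
          linarith [ind_le_one (X x ∧ ((∃ u, yl s = some u ∧ u - s * a x = gl x t) ∨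
            (yl s = none ∧ ∃ u, yr t = some u ∧ u - t * a x = gr x s))),
            ind_nonneg (yl s = none ∧ X x ∧ ∃ u, yr t = some u ∧ u - t * a x = gr x s)]
        · rw [ind_of_not h, zero_add]
          refine ind_mono ?_
          rintro ⟨hx, h' | h'⟩
          · exact absurd ⟨hx, h'⟩ h
          · exact ⟨h'.1, hx, h'.2⟩
    _ = ∑ t, (∑ x, ∑ s, ind (X x ∧ ∃ u, yl s = some u ∧ u - s * a x = gl x t)) +
        ∑ s, ind (yl s = none) *
          ∑ x, ∑ t, ind (X x ∧ ∃ u, yr t = some u ∧ u - t * a x = gr x s) := by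
        simp only [sum_add_distrib]
        congr 1
        · rw [sum_comm' (t' := univ) (s' := fun _ => univ) (by simp)]
          rw [sum_comm]
          conv_rhs => rw [sum_comm]
          refine sum_congr rfl fun x _ => ?_
          rw [sum_comm]
        · rw [sum_comm]
          simp only [mul_sum]
    _ ≤ ∑ _t : F, (S * P + √S * M) + ∑ s, ind (yl s = none) * (Q * P + √Q * M) := by
        gcongr with t _ s _
        · exact hl t
        · exact ind_nonneg _
        · exact hr s
    _ = Q * (S * P + √S * M) + (Q - S) * (Q * P + √Q * M) := by
        rw [← sum_mul, hnone, sum_const, nsmul_eq_mul, card_univ]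
    _ ≤ _ := by
        have hq := Real.sqrt_pos.2 hQ0
        have hq2 := Real.mul_self_sqrt hQ0.le
        have hr2 := Real.mul_self_sqrt hS0
        set q := √Q
        set r := √S
        have e : 5 / (4 * q) * M = 5 / 4 * (q * M) / Q := by
          rw [← hq2]; field_simp
        have e' : Q ^ 2 * (P + 5 / (4 * q) * M) = Q ^ 2 * P + 5 / 4 * Q * (q * M) := by
          rw [e]; field_simp
        rw [e', ← hr2, ← hq2]
        -- Source of `5/4`: `q² r + (q² - r²) q = (5/4) q³ - q (r - q/2)²`, so the worst case is a
        -- left child alive for a quarter of its challenges.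
        have : 0 ≤ q * M * (r - q / 2) ^ 2 := by positivity
        nlinarith [this]

end Incidence

/-! ### Locality of the path and of `alpha`; blind guesses -/

section Run

variable {k : ℕ} {F : Type*} [Field F] {Acc : Node → Set (Internal k)}
  (C : CommitStrategy F) (O : OpenStrategy k F Acc C.Λ) (l : C.Λ)

theorem challenge_congr {b b' : Challenges k F} {v : Node}
    (h : ∀ w : Internal k, w.1 = v → b w = b' w) : challenge b v = challenge b' v := by
  unfold challenge
  split_ifs with hv
  · exact h _ rfl
  · rfl

theorem answerAt_congr (hA : IsAccess k Acc) {b b' : Challenges k F} {v : Node}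
    (hv : v.length < k) (h : ∀ w : Internal k, w.1.length ≤ v.length → b w = b' w) :
    answerAt C O l b v = answerAt C O l b' v := by
  cases v with
  | nil =>
    simp only [answerAt]
    rw [challenge_congr fun w hw => h w (by simp [hw])]
  | cons t u => exact O.answer_local l _ fun w hw => h w (hA _ hv.le w hw).1

theorem alpha_congr (hA : IsAccess k Acc) (d : Bool) {b b' : Challenges k F} {v : Node}
    (hv : v.length < k) (h : ∀ w : Internal k, w.1.length ≤ v.length → b w = b' w) :
    alpha C O l b d v = alpha C O l b' d v := by
  induction v with
  | nil =>
    simp only [alpha]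
    rw [answerAt_congr C O l hA hv h, challenge_congr fun w hw => h w (by simp [hw])]
  | cons t u ih =>
    simp only [alpha]
    rw [answerAt_congr C O l hA hv h, challenge_congr fun w hw => h w (by simp [hw]),
      ih (by simp at hv; omega) fun w hw => h w (by simp; omega)]

theorem leftmostAlive_length {b : Challenges k F} {n : ℕ} {v : Node}
    (h : leftmostAlive C O l b n = some v) : v.length = n := by
  induction n generalizing v with
  | zero =>
    rw [leftmostAlive] at h
    split_ifs at h
    simp at h
    simp [← h]
  | succ n ih =>
    rw [leftmostAlive, Option.bind_eq_some_iff] at h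
    obtain ⟨u, hu, h⟩ := h
    have := ih hu
    split_ifs at h <;> simp at h <;> simp [← h, this]

theorem responds_iff {b : Challenges k F} {v : Node} (hv : v.length < k) :
    Responds C O l b v ↔ (answerAt C O l b v).isSome := by
  simp [Responds, hv]

/-- Accessible challenges are never deeper than the node. Hence challenges below depth `n` can be
resampled without moving the path up to that depth. -/
theorem leftmostAlive_congr (hA : IsAccess k Acc) {b b' : Challenges k F} {n : ℕ} (hn : n < k)
    (h : ∀ w : Internal k, w.1.length ≤ n → b w = b' w) :
    leftmostAlive C O l b n = leftmostAlive C O l b' n := by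
  have hresp : ∀ v : Node, v.length ≤ n → (Responds C O l b v ↔ Responds C O l b' v) := by
    intro v hv
    rw [responds_iff C O l (by omega), responds_iff C O l (by omega),
      answerAt_congr C O l hA (by omega) fun w hw => h w (by omega)]
  induction n with
  | zero => rw [leftmostAlive, leftmostAlive, propext (hresp [] (by simp))]
  | succ n ih =>
    rw [leftmostAlive, leftmostAlive, ih (by omega) (fun w hw => h w (by omega))
      fun v hv => hresp v (by omega)]
    cases hu : leftmostAlive C O l b' n with
    | none => rfl
    | some v =>
      have hl := leftmostAlive_length C O l hu
      simp only [Option.bind_some]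
      rw [propext (hresp (false :: v) (by simp [hl])), propext (hresp (true :: v) (by simp [hl]))]

/-- `leftmostAlive b n` is `v`, and the guess `g v b` of the value computed by Bob at `v` is
correct. -/
def Guesses (d : Bool) (n : ℕ) (g : Internal k → Challenges k F → F) (b : Challenges k F) : Prop :=
  ∃ v : Internal k, leftmostAlive C O l b n = some v.1 ∧ alpha C O l b d v.1 = g v b

/-- The guess `g v` at the node `v` is made without knowledge of the challenge at `v`. -/
def IsBlind (g : Internal k → Challenges k F → F) : Prop :=
  ∀ v b z, g v (update b v z) = g v b

/-- Neither leaf below `v` sees the challenge of `v`, so the value revealed by the left leaf, or by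
the right one if the left is silent, is a blind guess. The default `0` matters only when both are
silent and the protocol aborts. -/
theorem exists_blind_of_reveals (hA : IsAccess k Acc) (hk : 1 ≤ k) (d : Bool) :
    ∃ g, IsBlind g ∧ ∀ b, Reveals C O l b d → Guesses C O l d (k - 1) g b := by
  refine ⟨fun v b => (((O.reveal l (false :: v.1) b).or
    (O.reveal l (true :: v.1) b)).map Prod.snd).getD 0, ?_, ?_⟩
  · intro v b z
    by_cases hv : v.1.length + 1 ≤ k; swap
    · exact absurd v.2 (by omega)
    have : ∀ t, O.reveal l (t :: v.1) (update b v z) = O.reveal l (t :: v.1) b := by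
      intro t
      refine O.reveal_local l _ fun w hw => update_of_ne ?_ _ _
      rintro rfl
      exact (hA (t :: w.1) hv w hw).2.1 ⟨t, rfl⟩
    simp only [this]
  · rintro b ⟨v, hv, hr⟩
    obtain ⟨n, rfl⟩ : ∃ n, k = n + 1 := ⟨k - 1, by omega⟩
    rw [leftmostAlive, Option.bind_eq_some_iff] at hv
    obtain ⟨u, hu, hv⟩ := hv
    have hul := leftmostAlive_length C O l hu
    refine ⟨⟨u, by omega⟩, hu, ?_⟩
    have hresp : ∀ t, Responds C O l b (t :: u) ↔ (O.reveal l (t :: u) b).isSome := by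
      intro t
      simp [Responds, hul]
    simp only [hresp] at hv
    split_ifs at hv with h1 h2
    · simp only [Option.some.injEq] at hv
      subst hv
      simp [hr]
    · simp only [Option.some.injEq] at hv
      subst hv
      have h1' : O.reveal l (false :: u) b = none := by simpa using h1
      simp [hr, h1']

/-- The most frequent value of `α v`, with the challenge at `v` summed out, cannot depend on that
challenge. This turns the slope multiplicity `P` of the incidence bound into the success count of a
guess. -/
theorem exists_blind_argmax [Fintype F] (A : Internal k → Challenges k F → Prop)
    (α : Internal k → Challenges k F → F) :
    ∃ g, IsBlind g ∧ ∀ v b a₀, ∑ x, ind (A v (update b v x) ∧ α v (update b v x) = a₀) ≤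
      ∑ x, ind (A v (update b v x) ∧ α v (update b v x) = g v (update b v x)) := by
  have hmax := fun f : F → ℝ => Finite.exists_max f
  choose m hm using hmax
  have hb : IsBlind fun v b => m fun a₀ => ∑ x, ind (A v (update b v x) ∧ α v (update b v x) = a₀) := by
    intro v b z
    simp only [update_idem]
  refine ⟨_, hb, fun v b a₀ => ?_⟩
  simp only [hb v b]
  exact hm (fun a₀ => ∑ x, ind (A v (update b v x) ∧ α v (update b v x) = a₀)) a₀

end Run

/-! ### From the children to the parent, and the root -/

section Bound

variable {k : ℕ} {F : Type*} [Field F] {Acc : Node → Set (Internal k)}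
  (C : CommitStrategy F) (O : OpenStrategy k F Acc C.Λ) (l : C.Λ)

/-- The left child of `v`, if alive, and otherwise the right one receives a correct guess. -/
def ChildGuesses (d : Bool) (g : Internal k → Challenges k F → F) (v : Node) (vl vr : Internal k)
    (b : Challenges k F) : Prop :=
  (∃ u, O.answer l vl.1 b = some u ∧ u - b vl * alpha C O l b d v = g vl b) ∨
    (O.answer l vl.1 b = none ∧
      ∃ u, O.answer l vr.1 b = some u ∧ u - b vr * alpha C O l b d v = g vr b)

theorem childGuesses_of_guesses (d : Bool) {n : ℕ} (hn : n + 1 < k)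
    {g : Internal k → Challenges k F → F} {b : Challenges k F}
    (h : Guesses C O l d (n + 1) g b) :
    ∃ v : Internal k, leftmostAlive C O l b n = some v.1 ∧
      ∀ vl vr : Internal k, vl.1 = false :: v.1 → vr.1 = true :: v.1 →
        ChildGuesses C O l d g v.1 vl vr b := by
  obtain ⟨⟨w, hw⟩, h, hg⟩ := h
  rw [leftmostAlive, Option.bind_eq_some_iff] at h
  obtain ⟨v, hv, h⟩ := h
  have hvl := leftmostAlive_length C O l hv
  refine ⟨⟨v, by omega⟩, hv, ?_⟩
  rintro ⟨-, hl⟩ ⟨-, hr⟩ rfl rfl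
  have ch : ∀ t (ht : (t :: v).length < k), challenge b (t :: v) = b ⟨t :: v, ht⟩ :=
    fun t ht => dif_pos ht
  simp only [responds_iff C O l hl, responds_iff C O l hr, answerAt] at h
  split_ifs at h with h1 h2
  · left
    simp only [Option.some.injEq] at h
    subst h
    obtain ⟨u, hu⟩ := Option.isSome_iff_exists.1 h1
    refine ⟨u, hu, ?_⟩
    simpa [alpha, answerAt, hu, ch _ hl] using hg
  · right
    simp only [Option.some.injEq] at h
    subst h
    obtain ⟨u, hu⟩ := Option.isSome_iff_exists.1 h2
    refine ⟨by simpa using h1, u, hu, ?_⟩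
    simpa [alpha, answerAt, hu, ch _ hr] using hg

variable [Fintype F] [Fintype (Internal k)]

/-- The contribution of a node `v` to the success probability of blind guesses at its children,
compared with that of a blind guess at `v`. -/
theorem sum_childGuesses_le (hA : IsAccess k Acc) (d : Bool)
    {g g' : Internal k → Challenges k F → F} (hg : IsBlind g) {v vl vr : Internal k}
    (hvl : vl.1 = false :: v.1) (hvr : vr.1 = true :: v.1)
    (hmax : ∀ b a₀,
      ∑ x, ind (leftmostAlive C O l (update b v x) v.1.length = some v.1 ∧
        alpha C O l (update b v x) d v.1 = a₀) ≤
      ∑ x, ind (leftmostAlive C O l (update b v x) v.1.length = some v.1 ∧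
        alpha C O l (update b v x) d v.1 = g' v (update b v x))) :
    ∑ b, ind (leftmostAlive C O l b v.1.length = some v.1 ∧ ChildGuesses C O l d g v.1 vl vr b) ≤
      ∑ b, ind (leftmostAlive C O l b v.1.length = some v.1 ∧ alpha C O l b d v.1 = g' v b) +
        5 / (4 * √(Fintype.card F)) *
          ∑ b, ind (leftmostAlive C O l b v.1.length = some v.1) := by
  classical
  have hQ0 : (0 : ℝ) < Fintype.card F := Nat.cast_pos.2 Fintype.card_pos
  have nl : vl ≠ v := fun h => by simp [← h] at hvl
  have nr : vr ≠ v := fun h => by simp [← h] at hvr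
  have nlr : vl ≠ vr := fun h => by simp [← h, hvl] at hvr
  have hlen : ∀ (b : Challenges k F) x s t, ∀ w : Internal k, w.1.length ≤ v.1.length →
      update (update (update b v x) vl s) vr t w = update b v x w := by
    intro b x s t w hw
    rw [update_of_ne, update_of_ne]
    · rintro rfl; simp [hvl] at hw
    · rintro rfl; simp [hvr] at hw
  have eA : ∀ b x s t,
      leftmostAlive C O l (update (update (update b v x) vl s) vr t) v.1.length =
        leftmostAlive C O l (update b v x) v.1.length := fun b x s t =>
    leftmostAlive_congr C O l hA v.2 (hlen b x s t)
  have ea : ∀ b x s t, alpha C O l (update (update (update b v x) vl s) vr t) d v.1 =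
      alpha C O l (update b v x) d v.1 := fun b x s t =>
    alpha_congr C O l hA d v.2 (hlen b x s t)
  -- Of the challenges at `v`, `vl`, `vr`, a child's answer can depend only on its own: the other
  -- two belong to its parent and its brother.
  have nmem : ∀ w : Internal k, w = vl ∨ w = vr → ∀ w' ∈ Acc w.1, w' ≠ v ∧
      (w' = vl → w = vl) ∧ (w' = vr → w = vr) := by
    intro w hw w' hw'
    have := (hA w.1 w.2.le w' hw').2
    refine ⟨?_, ?_, ?_⟩
    · rintro rfl
      refine this.1 ?_
      rcases hw with rfl | rfl
      exacts [⟨_, hvl⟩, ⟨_, hvr⟩]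
    · rintro rfl
      refine hw.resolve_right ?_
      rintro rfl
      exact this.2 ⟨true, v.1, hvr, hvl⟩
    · rintro rfl
      refine hw.resolve_left ?_
      rintro rfl
      exact this.2 ⟨false, v.1, hvl, hvr⟩
  have el : ∀ b x s t, O.answer l vl.1 (update (update (update b v x) vl s) vr t) =
      O.answer l vl.1 (update b vl s) := by
    intro b x s t
    refine O.answer_local l _ fun w hw => ?_
    obtain ⟨h1, -, h2⟩ := nmem vl (Or.inl rfl) w hw
    rw [update_of_ne fun h => nlr (h2 h)]
    by_cases h : w = vl
    · subst h; simp
    · simp [h, h1]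
  have er : ∀ b x s t, O.answer l vr.1 (update (update (update b v x) vl s) vr t) =
      O.answer l vr.1 (update b vr t) := by
    intro b x s t
    refine O.answer_local l _ fun w hw => ?_
    obtain ⟨h1, h2, -⟩ := nmem vr (Or.inr rfl) w hw
    by_cases h : w = vr
    · subst h; simp
    · simp [h, h1, show w ≠ vl from fun h => nlr (h2 h).symm]
  -- Guesses may use the challenges of the parent and the brother; only the node's own challenge
  -- drops out.
  have gl : ∀ b x s t, g vl (update (update (update b v x) vl s) vr t) =
      g vl (update (update b v x) vr t) := by
    intro b x s t
    rw [update_comm nlr, hg]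
  have gr : ∀ b x s t, g vr (update (update (update b v x) vl s) vr t) =
      g vr (update (update b v x) vl s) := fun b x s t => hg _ _ _
  have key : ∀ b, ∑ x, ∑ s, ∑ t,
      ind (leftmostAlive C O l (update (update (update b v x) vl s) vr t) v.1.length = some v.1 ∧
        ChildGuesses C O l d g v.1 vl vr (update (update (update b v x) vl s) vr t)) ≤
      (Fintype.card F : ℝ) ^ 2 *
        (∑ x, ind (leftmostAlive C O l (update b v x) v.1.length = some v.1 ∧
            alpha C O l (update b v x) d v.1 = g' v (update b v x)) +
          5 / (4 * √(Fintype.card F)) *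
            ∑ x, ind (leftmostAlive C O l (update b v x) v.1.length = some v.1)) := by
    intro b
    refine le_of_eq_of_le ?_ (sum_incidence_children_le
      (fun x => leftmostAlive C O l (update b v x) v.1.length = some v.1)
      (fun x => alpha C O l (update b v x) d v.1)
      (fun x t => g vl (update (update b v x) vr t)) (fun x s => g vr (update (update b v x) vl s))
      (fun s => O.answer l vl.1 (update b vl s)) (fun t => O.answer l vr.1 (update b vr t))
      (hmax b))
    simp only [ChildGuesses, eA, ea, el, er, gl, gr, update_self, update_of_ne nlr]
  have sum := sum_le_sum fun b (_ : b ∈ univ) => key b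
  simp only [← mul_sum, sum_add_distrib] at sum
  rw [sum_sum_update v fun b => ∑ s, ∑ t, ind (leftmostAlive C O l (update (update b vl s) vr t)
      v.1.length = some v.1 ∧ ChildGuesses C O l d g v.1 vl vr (update (update b vl s) vr t)),
    sum_sum_update vl fun b => ∑ t, ind (leftmostAlive C O l (update b vr t)
      v.1.length = some v.1 ∧ ChildGuesses C O l d g v.1 vl vr (update b vr t)),
    sum_sum_update vr fun b => ind (leftmostAlive C O l b v.1.length = some v.1 ∧
      ChildGuesses C O l d g v.1 vl vr b),
    sum_sum_update v fun b => ind (leftmostAlive C O l b v.1.length = some v.1 ∧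
      alpha C O l b d v.1 = g' v b),
    sum_sum_update v fun b => ind (leftmostAlive C O l b v.1.length = some v.1)] at sum
  -- Three resamplings on the left give `Q³`; on the right, `Q²` comes from the incidence bound and
  -- `Q` from resampling at `v`.
  refine le_of_mul_le_mul_left ?_ (pow_pos hQ0 3)
  linarith

/-- One round decreases the success probability of blind guesses by at most `5 / (4 √|F|)`. -/
theorem exists_blind_guesses_pred (hA : IsAccess k Acc) (d : Bool) {n : ℕ} (hn : n + 1 < k)
    {g : Internal k → Challenges k F → F} (hg : IsBlind g) :
    ∃ g', IsBlind g' ∧ ∑ b, ind (Guesses C O l d (n + 1) g b) ≤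
      ∑ b, ind (Guesses C O l d n g' b) +
        5 / (4 * √(Fintype.card F)) * Fintype.card (Challenges k F) := by
  obtain ⟨g', hg', hmax⟩ := exists_blind_argmax
    (fun (v : Internal k) b => leftmostAlive C O l b v.1.length = some v.1)
    (fun v b => alpha C O l b d v.1)
  refine ⟨g', hg', ?_⟩
  set c : ℝ := 5 / (4 * √(Fintype.card F)) with hc
  have hc0 : 0 ≤ c := by positivity
  let Ch (b : Challenges k F) (v : Internal k) : Prop :=
    ∀ vl vr : Internal k, vl.1 = false :: v.1 → vr.1 = true :: v.1 →
      ChildGuesses C O l d g v.1 vl vr b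
  have node : ∀ v : Internal k, ∑ b, ind (leftmostAlive C O l b n = some v.1 ∧ Ch b v) ≤
      ∑ b, ind (leftmostAlive C O l b n = some v.1 ∧ alpha C O l b d v.1 = g' v b) +
        c * ∑ b, ind (leftmostAlive C O l b n = some v.1 ∧ True) := by
    intro v
    by_cases hv : v.1.length = n
    · subst hv
      let vl : Internal k := ⟨false :: v.1, by simpa using hn⟩
      let vr : Internal k := ⟨true :: v.1, by simpa using hn⟩
      simp only [and_true]
      refine le_trans (sum_le_sum fun b _ => ind_mono ?_)
        (sum_childGuesses_le C O l hA d hg (vl := vl) (vr := vr) rfl rfl (hmax v))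
      exact fun h => ⟨h.1, h.2 vl vr rfl rfl⟩
    · have : ∀ b (p : Prop), ind (leftmostAlive C O l b n = some v.1 ∧ p) = 0 := fun b p =>
        ind_of_not fun h => hv (leftmostAlive_length C O l h.1)
      simp only [this, sum_const_zero, mul_zero, add_zero, le_refl]
  have inj : Injective (Subtype.val : Internal k → Node) := Subtype.val_injective
  calc ∑ b, ind (Guesses C O l d (n + 1) g b)
      ≤ ∑ b, ind (∃ v : Internal k, leftmostAlive C O l b n = some v.1 ∧ Ch b v) :=
        sum_le_sum fun b _ => ind_mono (childGuesses_of_guesses C O l d hn)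
    _ = ∑ v : Internal k, ∑ b, ind (leftmostAlive C O l b n = some v.1 ∧ Ch b v) := by
        rw [sum_comm]
        exact sum_congr rfl fun b _ => (sum_ind_some inj _ _).symm
    _ ≤ _ := sum_le_sum fun v _ => node v
    _ = ∑ b, ind (Guesses C O l d n g' b) +
        c * ∑ b, ind (∃ v : Internal k, leftmostAlive C O l b n = some v.1 ∧ True) := by
        rw [sum_add_distrib, ← mul_sum, sum_comm]
        conv_lhs => enter [2, 2]; rw [sum_comm]
        congr 2
        · funext b
          exact sum_ind_some inj _ _
        · exact sum_congr rfl fun b _ => sum_ind_some inj _ _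
    _ ≤ _ := by
        gcongr
        exact (sum_le_sum fun b _ => ind_le_one _).trans (by simp)

theorem exists_blind_guesses_root (hA : IsAccess k Acc) (d : Bool) {n : ℕ} (hn : n < k)
    {g : Internal k → Challenges k F → F} (hg : IsBlind g) :
    ∃ g', IsBlind g' ∧ ∑ b, ind (Guesses C O l d n g b) ≤
      ∑ b, ind (Guesses C O l d 0 g' b) +
        n * (5 / (4 * √(Fintype.card F)) * Fintype.card (Challenges k F)) := by
  induction n generalizing g with
  | zero => exact ⟨g, hg, by simp⟩
  | succ n ih =>
    obtain ⟨g₁, hg₁, h₁⟩ := exists_blind_guesses_pred C O l hA d hn hg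
    obtain ⟨g₂, hg₂, h₂⟩ := ih (by omega) hg₁
    refine ⟨g₂, hg₂, ?_⟩
    push_cast
    linarith

theorem exists_sum_ind_reveals_le (hA : IsAccess k Acc) (hk : 1 ≤ k) (d : Bool) :
    ∃ g, IsBlind g ∧ ∑ b, ind (Reveals C O l b d) ≤ ∑ b, ind (Guesses C O l d 0 g b) +
      (k - 1) * (5 / (4 * √(Fintype.card F)) * Fintype.card (Challenges k F)) := by
  obtain ⟨g, hg, h⟩ := exists_blind_of_reveals C O l hA hk d
  obtain ⟨g', hg', h'⟩ := exists_blind_guesses_root C O l hA d (n := k - 1) (by omega) hg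
  refine ⟨g', hg', (sum_le_sum fun b _ => ind_mono (h b)).trans (h'.trans (le_of_eq ?_))⟩
  rw [Nat.cast_sub hk, Nat.cast_one]

/-- Blind guesses at the root for the two bits are both correct for at most one value of the
challenge at the root. -/
theorem sum_guesses_root_le (hk : 1 ≤ k) (O' : OpenStrategy k F Acc C.Λ)
    {g g' : Internal k → Challenges k F → F} (hg : IsBlind g) (hg' : IsBlind g') :
    ∑ b, ind (Guesses C O l false 0 g b) + ∑ b, ind (Guesses C O' l true 0 g' b) ≤
      (1 + 1 / (Fintype.card F : ℝ)) * Fintype.card (Challenges k F) := by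
  have hQ0 : (0 : ℝ) < Fintype.card F := Nat.cast_pos.2 Fintype.card_pos
  let ρ : Internal k := ⟨[], hk⟩
  have root : ∀ (O : OpenStrategy k F Acc C.Λ) d g b, Guesses C O l d 0 g b →
      ∃ u, C.answer l (b ρ) = some u ∧ u - b ρ * (if d then 1 else 0) = g ρ b := by
    rintro O d g b ⟨v, hv, h⟩
    have hl : v = ρ := Subtype.ext (List.length_eq_zero_iff.1 (leftmostAlive_length C O l hv))
    subst hl
    have hch : challenge b [] = b ρ := dif_pos hk
    rw [leftmostAlive] at hv
    split_ifs at hv with hr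
    rw [responds_iff C O l (v := []) hk] at hr
    obtain ⟨u, hu⟩ := Option.isSome_iff_exists.1 hr
    rw [answerAt, hch] at hu
    refine ⟨u, hu, ?_⟩
    simpa [ρ, alpha, answerAt, hch, hu] using h
  have key : ∀ b, ∑ x, (ind (Guesses C O l false 0 g (update b ρ x)) +
      ind (Guesses C O' l true 0 g' (update b ρ x))) ≤ Fintype.card F + 1 := by
    intro b
    -- With all other challenges fixed, blindness makes both guesses constants, and subtracting the
    -- two equations for the common answer determines `x`.
    calc _ ≤ ∑ x, (1 + ind (x = g ρ b - g' ρ b)) := by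
          refine sum_le_sum fun x _ => ?_
          by_cases h : Guesses C O l false 0 g (update b ρ x)
          · by_cases h' : Guesses C O' l true 0 g' (update b ρ x)
            · obtain ⟨u, hu, e⟩ := root _ _ _ _ h
              obtain ⟨u', hu', e'⟩ := root _ _ _ _ h'
              obtain rfl : u = u' := by simpa using hu.symm.trans hu'
              rw [hg] at e
              rw [hg'] at e'
              simp only [update_self, Bool.false_eq_true, if_false, if_true] at e e'
              rw [ind_of (p := x = _) (by linear_combination e - e'), ind_of h, ind_of h']
            · rw [ind_of_not h']
              linarith [ind_le_one (Guesses C O l false 0 g (update b ρ x)),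
                ind_nonneg (x = g ρ b - g' ρ b)]
          · rw [ind_of_not h]
            linarith [ind_le_one (Guesses C O' l true 0 g' (update b ρ x)),
              ind_nonneg (x = g ρ b - g' ρ b)]
      _ = _ := by simp [sum_add_distrib, sum_ind_eq_self]
  have sum := sum_le_sum fun b (_ : b ∈ univ) => key b
  rw [sum_sum_update ρ fun b => ind (Guesses C O l false 0 g b) +
    ind (Guesses C O' l true 0 g' b), sum_add_distrib, sum_const, nsmul_eq_mul, card_univ] at sum
  refine le_of_mul_le_mul_left (sum.trans (le_of_eq ?_)) hQ0
  field_simp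

end Bound

/-! ### Constants, shared randomness and suprema -/

theorem sum_card_reveals_le {k : ℕ} {F : Type*} [Field F] [Fintype F]
    {Acc : Node → Set (Internal k)} (C : CommitStrategy F) (O O' : OpenStrategy k F Acc C.Λ)
    (l : C.Λ) (hA : IsAccess k Acc) (hk : 1 ≤ k) :
    (Nat.card {b : Challenges k F // Reveals C O l b false} : ℝ) / Nat.card (Challenges k F) +
      (Nat.card {b : Challenges k F // Reveals C O' l b true} : ℝ) / Nat.card (Challenges k F) ≤
      1 + 5 * (k : ℝ) / √(2 * (Fintype.card F : ℝ)) := by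
  have := Fintype.ofFinite (Internal k)
  classical
  obtain ⟨g, hg, h⟩ := exists_sum_ind_reveals_le C O l hA hk false
  obtain ⟨g', hg', h'⟩ := exists_sum_ind_reveals_le C O' l hA hk true
  have h0 := sum_guesses_root_le C O l hk O' hg hg'
  rw [sum_ind_eq_card] at h h'
  have hN : (0 : ℝ) < Fintype.card (Challenges k F) := Nat.cast_pos.2 Fintype.card_pos
  rw [← add_div, Nat.card_eq_fintype_card (α := Challenges k F), div_le_iff₀ hN]
  have hQ : (1 : ℝ) ≤ Fintype.card F := Nat.one_le_cast.2 Fintype.card_pos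
  have hk' : (1 : ℝ) ≤ k := Nat.one_le_cast.2 hk
  set Q : ℝ := (Fintype.card F : ℝ)
  set N : ℝ := (Fintype.card (Challenges k F) : ℝ)
  have hq : 0 < √Q := Real.sqrt_pos.2 (by linarith)
  have h1 : 1 / Q ≤ 1 / √Q := by
    refine one_div_le_one_div_of_le hq ?_
    exact Real.sqrt_le_iff.2 ⟨by linarith, by nlinarith⟩
  -- `10/3` is `5 / (3/2)`, from `√2 ≤ 3/2`. There is slack: the two bits cost `5/2` per round, in
  -- units of `1 / √Q`.
  have h2 : 10 / 3 * (k * (1 / √Q)) ≤ 5 * (k : ℝ) / √(2 * Q) := by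
    rw [Real.sqrt_mul (by norm_num) Q]
    have : √2 ≤ 3 / 2 := Real.sqrt_le_iff.2 (by norm_num)
    have h2 : 0 < √2 := by positivity
    rw [le_div_iff₀ (by positivity)]
    field_simp
    nlinarith
  have h3 : 5 / (4 * √Q) = 5 / 4 * (1 / √Q) := by field_simp
  rw [h3] at h h'
  have h4 : 0 < 1 / √Q := by positivity
  set ε := 1 / √Q
  have h5 : 1 + 1 / Q + 2 * ((k - 1) * (5 / 4 * ε)) ≤ 1 + 5 * (k : ℝ) / √(2 * Q) := by
    nlinarith
  have h6 := mul_le_mul_of_nonneg_right h5 hN.le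
  linarith

/-- Both openings follow the same commitment, hence the same law of `l`, so the bound for each `l`
can be averaged. -/
theorem revealProb_add_le {k : ℕ} {F : Type*} [Field F] [Fintype F]
    {Acc : Node → Set (Internal k)} (C : CommitStrategy F) {ε : ℝ}
    (O O' : OpenStrategy k F Acc C.Λ)
    (h : ∀ l, (Nat.card {b : Challenges k F // Reveals C O l b false} : ℝ) /
        Nat.card (Challenges k F) +
      (Nat.card {b : Challenges k F // Reveals C O' l b true} : ℝ) /
        Nat.card (Challenges k F) ≤ 1 + ε) :
    revealProb C O false + revealProb C O' true ≤ 1 + ε := by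
  have hs : Summable fun l : C.Λ => (C.law l).toReal :=
    ENNReal.summable_toReal C.law.tsum_coe_ne_top
  have ht : ∑' l : C.Λ, (C.law l).toReal = 1 := by
    rw [← ENNReal.tsum_toReal_eq C.law.apply_ne_top, C.law.tsum_coe, ENNReal.toReal_one]
  have summ : ∀ (O : OpenStrategy k F Acc C.Λ) d, Summable fun l : C.Λ => (C.law l).toReal *
      ((Nat.card {b : Challenges k F // Reveals C O l b d} : ℝ) / Nat.card (Challenges k F)) := by
    intro O d
    refine Summable.of_nonneg_of_le (fun l => by positivity) (fun l => ?_) hs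
    refine mul_le_of_le_one_right ENNReal.toReal_nonneg (div_le_one_of_le₀ ?_ (by positivity))
    exact_mod_cast Nat.card_le_card_of_injective _ Subtype.val_injective
  rw [revealProb, revealProb, ← (summ O false).tsum_add (summ O' true)]
  refine (Summable.tsum_le_tsum (fun l => ?_) ((summ O false).add (summ O' true))
    (hs.mul_right (1 + ε))).trans ?_
  · rw [← mul_add]
    exact mul_le_mul_of_nonneg_left (h l) ENNReal.toReal_nonneg
  · rw [tsum_mul_right, ht, one_mul]

theorem treeIsSumBinding_of_isAccess {k : ℕ} (hk : 1 ≤ k) (F : Type*) [Field F] [Fintype F]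
    {Acc : Node → Set (Internal k)} (hA : IsAccess k Acc) :
    TreeIsSumBinding k F Acc (5 * (k : ℝ) / √(2 * (Fintype.card F : ℝ))) := by
  intro C
  rw [Fintype.sum_bool]
  -- The bound holds for every pair of openings, so the suprema can be taken one after the other;
  -- `Fintype.sum_bool` lists `true` first.
  refine add_le_of_le_sub_right (ciSup_le fun O' => le_sub_iff_add_le'.2 ?_)
  refine add_le_of_le_sub_right (ciSup_le fun O => le_sub_iff_add_le.2 ?_)
  exact revealProb_add_le C O O' fun l => sum_card_reveals_le C O O' l hA hk

end TreeCommitment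

theorem mainTheorem1 (k : ℕ) (hk : 1 ≤ k) (F : Type*) [Field F] [Fintype F] :
    (∀ Acc : TreeCommitment.Node → Set (TreeCommitment.Internal k),
      TreeCommitment.IsAccess k Acc →
        TreeCommitment.TreeIsSumBinding k F Acc
          (5 * (k : ℝ) / Real.sqrt (2 * (Fintype.card F : ℝ)))) ∧
    (∀ c : TreeCommitment.Node → Fin 3, TreeCommitment.IsColoring k c →
        TreeCommitment.TreeIsSumBinding k F (TreeCommitment.lightCone k c)
          (5 * (k : ℝ) / Real.sqrt (2 * (Fintype.card F : ℝ)))) :=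
  ⟨fun _ hA => TreeCommitment.treeIsSumBinding_of_isAccess hk F hA,
    fun _ hc => TreeCommitment.treeIsSumBinding_of_isAccess hk F
      (TreeCommitment.lightCone_isAccess hc)⟩
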